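/- All rings are commutative with $1$. A quasi-identity is a universally quantified implication $(s_1=t_1)\wedge\dots\wedge(s_n=t_n)\to(s_0=t_0)$ between terms $s_i,t_i$ in the language $(+,\cdot,-,0,1)$ of rings, $n\ge 0$; for $n=0$ it is called an identity. A variety (resp. quasivariety) is a class axiomatized by identities (resp. quasi-identities). Let $\mathcal Q$ be the class of all commutative rings $R$ with $1$ such that each principal ideal of $R$ has a unique generator, and let $\mathcal D$ be the class of domains in $\mathcal Q$. (1) $\mathcal Q$ is a quasivariety. It is exactly the class of rings axiomatized by the quasi-identity $(xyz=z)\to(yz=z)$ along with the identities defining the variety of all commutative rings. Every ring in $\mathcal Q$ has trivial unit group, is reduced, and is an $\mathbb F_2$-algebra. (2) $\mathcal D$ is exactly the class of domains with trivial unit group. (3) $\mathcal Q=\mathsf{SP}(\mathcal D)$, that is, $\mathcal Q$ consists of the rings isomorphic to subrings of (possibly empty) products of members of $\mathcal D$. (4) $\mathcal Q$ is a relatively ideal distributive quasivariety: for each $R\in\mathcal Q$, the set of $\mathcal Q$-ideals of $R$ (ideals $I$ with $R/I\in\mathcal Q$) is closed under arbitrary intersections, and for all $\mathcal Q$-ideals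 $I,J,K$ of $R$ one has $I\cap(J\vee K)=(I\cap J)\vee(I\cap K)$, where $A\vee B$ denotes the least $\mathcal Q$-ideal containing $A\cup B$. (5) The class of locally finite members of $\mathcal Q$ (those in which every finitely generated subring is finite) is exactly the class of Boolean rings (rings satisfying $x^2=x$). This class is the largest variety contained in $\mathcal Q$. -/

import Mathlib

universe u

namespace RingClasses

open FirstOrder FirstOrder.Language

/-- Terms in the language of rings `(+, *, -, 0, 1)`, with variables indexed by `ℕ`. -/
abbrev RingTerm : Type := Language.ring.Term ℕ

/-- A quasi-identity `(s₁ = t₁) ∧ ⋯ ∧ (sₙ = tₙ) → (s₀ = t₀)`, universally quantified, `n ≥ 0`;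
an equation is a pair of terms. -/
structure QuasiIdentity where
  premises : List (RingTerm × RingTerm)
  conclusion : RingTerm × RingTerm

/-- An identity is a quasi-identity without premises. -/
def QuasiIdentity.IsIdentity (φ : QuasiIdentity) : Prop := φ.premises = []

/-- The identity `s = t`. -/
def QuasiIdentity.ofEq (s t : RingTerm) : QuasiIdentity := ⟨[], (s, t)⟩

/-- Truth of a quasi-identity in an arbitrary algebra `M` of the signature of rings. -/
def QuasiIdentity.Holds (φ : QuasiIdentity) (M : Type u) [Language.ring.Structure M] : Prop :=
  ∀ v : ℕ → M, (∀ e ∈ φ.premises, e.1.realize v = e.2.realize v) →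
    φ.conclusion.1.realize v = φ.conclusion.2.realize v

/-- `K` is axiomatized by `Φ`: the algebras of the signature of rings which satisfy `Φ` are
exactly the (underlying algebras of) commutative rings in `K`. -/
def IsAxiomatizedBy (K : Set CommRingCat.{u}) (Φ : Set QuasiIdentity) : Prop :=
  ∀ (M : Type u) (S : Language.ring.Structure M),
    (∀ φ ∈ Φ, φ.Holds M) ↔
      ∃ _ : CommRing M, S = (FirstOrder.Ring.compatibleRingOfRing M).toStructure ∧
        CommRingCat.of M ∈ K

/-- A quasivariety (of commutative rings) is a class axiomatized by quasi-identities. -/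
def IsQuasivariety (K : Set CommRingCat.{u}) : Prop :=
  ∃ Φ : Set QuasiIdentity, IsAxiomatizedBy K Φ

/-- A variety (of commutative rings) is a class axiomatized by identities. -/
def IsVariety (K : Set CommRingCat.{u}) : Prop :=
  ∃ Φ : Set QuasiIdentity, (∀ φ ∈ Φ, φ.IsIdentity) ∧ IsAxiomatizedBy K Φ

/-- The variables `x`, `y`, `z`. -/
def X : RingTerm := Term.var 0
def Y : RingTerm := Term.var 1
def Z : RingTerm := Term.var 2

/-- The identities defining the variety of commutative rings with `1`. -/
def commRingIdentities : Set QuasiIdentity :=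
  { .ofEq ((X + Y) + Z) (X + (Y + Z)),
    .ofEq (X + Y) (Y + X),
    .ofEq (X + 0) X,
    .ofEq (X + -X) 0,
    .ofEq ((X * Y) * Z) (X * (Y * Z)),
    .ofEq (X * Y) (Y * X),
    .ofEq (X * 1) X,
    .ofEq (X * (Y + Z)) (X * Y + X * Z) }

/-- The quasi-identity `(xyz = z) → (yz = z)`. -/
def cancelQuasiIdentity : QuasiIdentity := ⟨[(X * Y * Z, Z)], (Y * Z, Z)⟩

/-- The class of commutative rings in which each principal ideal has a unique generator. -/
def uniqueGeneratorRings : Set CommRingCat.{u} :=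
  {R | ∀ I : Ideal R, I.IsPrincipal → ∃! a : R, Ideal.span {a} = I}

/-- The class of domains in a class of commutative rings. -/
def domainsIn (K : Set CommRingCat.{u}) : Set CommRingCat.{u} := {R | IsDomain R ∧ R ∈ K}

/-- `SP(K)`: the class of rings isomorphic to a subring of a product of members of `K`
(empty products are allowed). -/
def SP (K : Set CommRingCat.{u}) : Set CommRingCat.{u} :=
  {R | ∃ (ι : Type u) (D : ι → CommRingCat.{u}), (∀ i, D i ∈ K) ∧
    ∃ f : R →+* (∀ i, D i), Function.Injective f}

/-- The `K`-ideals (relative ideals) of `R`: the ideals `I` with `R ⧸ I ∈ K`. -/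
def relIdeals (K : Set CommRingCat.{u}) (R : Type u) [CommRing R] : Set (Ideal R) :=
  {I | CommRingCat.of (R ⧸ I) ∈ K}

/-- The join of two `K`-ideals: the intersection of all `K`-ideals containing both. It is the
least `K`-ideal containing both whenever the `K`-ideals are closed under intersection. -/
def relJoin (K : Set CommRingCat.{u}) {R : Type u} [CommRing R] (I J : Ideal R) : Ideal R :=
  sInf {L | L ∈ relIdeals K R ∧ I ≤ L ∧ J ≤ L}

/-- `K` is a relatively ideal distributive quasivariety: `K` is a quasivariety and, for each
`R ∈ K`, the set of `K`-ideals of `R` is closed under arbitrary intersections (hence is a lattice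
under inclusion with meet `⊓` and join `relJoin K`), and this lattice is distributive. -/
def IsRelativelyIdealDistributive (K : Set CommRingCat.{u}) : Prop :=
  IsQuasivariety K ∧ ∀ R ∈ K,
    (∀ S : Set (Ideal R), S ⊆ relIdeals K R → sInf S ∈ relIdeals K R) ∧
    ∀ I ∈ relIdeals K R, ∀ J ∈ relIdeals K R, ∀ L ∈ relIdeals K R,
      I ⊓ relJoin K J L = relJoin K (I ⊓ J) (I ⊓ L)

/-- A ring is locally finite if each of its finitely generated subrings is finite. -/
def IsLocallyFinite (R : Type u) [CommRing R] : Prop :=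
  ∀ s : Finset R, Finite (Subring.closure (s : Set R))

/-- The class of Boolean rings. -/
def booleanRings : Set CommRingCat.{u} := {R | ∀ a : R, a ^ 2 = a}

end RingClasses

/-! Since `z` and `y * z` generate the same ideal exactly when `x * y * z = z` for some `x`,
uniqueness of generators is the quasi-identity itself. The conditions on units, nilpotents and
characteristic are instances of it.

Parts (3) and (4) rest on one separation fact, `exists_isPrime_of_notMem`. Relative ideals are
closed under intersections, unions of chains and ideal quotients `(I : a)`, and are radical. Hence a
relative ideal maximal among those avoiding `r` is prime, so every relative ideal is an intersection
of prime ones. For the zero ideal this embeds the ring in a product of domains; distributivity holds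
because a prime containing `I ⊓ J` contains `I` or `J`.

For (5), finiteness makes the powers of `a` repeat, which forces `a ^ 2 - a` to be nilpotent. In a
variety, the quotient by `a * a` is again reduced, so `a` is a multiple of `a * a`, and the
quasi-identity gives `a * a = a`. -/

namespace RingClasses

open FirstOrder FirstOrder.Language

/-! ### Axiomatic classes of rings and the term language -/

section Axiomatization

/-- Every algebra of the signature of rings satisfying the commutative ring identities is the
underlying algebra of a commutative ring. -/
theorem exists_commRing_of_holds (M : Type u) [S : Language.ring.Structure M]
    (h : ∀ φ ∈ commRingIdentities, φ.Holds M) :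
    ∃ _ : CommRing M, S = (FirstOrder.Ring.compatibleRingOfRing M).toStructure := by
  let := FirstOrder.Ring.addOfRingStructure M
  let := FirstOrder.Ring.mulOfRingStructure M
  let := FirstOrder.Ring.negOfRingStructure M
  let := FirstOrder.Ring.zeroOfRingStructure M
  let := FirstOrder.Ring.oneOfRingStructure M
  let c : FirstOrder.Ring.CompatibleRing M := FirstOrder.Ring.compatibleRingOfRingStructure M
  simp only [commRingIdentities, Set.mem_insert_iff, Set.mem_singleton_iff, forall_eq_or_imp,
    forall_eq, QuasiIdentity.Holds, QuasiIdentity.ofEq, List.not_mem_nil, false_imp_iff,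
    implies_true, true_imp_iff, X, Y, Z, FirstOrder.Ring.realize_add, FirstOrder.Ring.realize_mul,
    FirstOrder.Ring.realize_neg, FirstOrder.Ring.realize_zero, FirstOrder.Ring.realize_one,
    Term.realize_var] at h
  obtain ⟨add_assoc', add_comm', add_zero', add_neg', mul_assoc', mul_comm', mul_one', distrib'⟩ :=
    h
  let v (a b c : M) : ℕ → M := fun n => if n = 0 then a else if n = 1 then b else c
  have hac (a b : M) : a + b = b + a := add_comm' (v a b b)
  have hmc (a b : M) : a * b = b * a := mul_comm' (v a b b)
  have hz (a : M) : a + 0 = a := add_zero' (v a a a)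
  have ho (a : M) : a * 1 = a := mul_one' (v a a a)
  have hn (a : M) : a + -a = 0 := add_neg' (v a a a)
  have hd (a b c : M) : a * (b + c) = a * b + a * c := distrib' (v a b c)
  have haa (a b c : M) : a + b + c = a + (b + c) := add_assoc' (v a b c)
  have hma (a b c : M) : a * b * c = a * (b * c) := mul_assoc' (v a b c)
  have hcancel (a b : M) (hab : a + a = a) : a = 0 := by
    rw [← hz a, ← hn a, ← haa, hab]
  have hmz (a : M) : a * 0 = 0 := hcancel _ a (by rw [← hd, hz])
  let R : CommRing M :=
    { add := (· + ·), mul := (· * ·), neg := (- ·), zero := 0, one := 1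
      add_assoc := haa, add_comm := hac, add_zero := hz
      zero_add := fun a => (hac 0 a).trans (hz a)
      neg_add_cancel := fun a => (hac _ a).trans (hn a)
      mul_assoc := hma, mul_comm := hmc, mul_one := ho
      one_mul := fun a => (hmc 1 a).trans (ho a)
      left_distrib := hd
      right_distrib := fun a b c => by
        change (a + b) * c = a * c + b * c
        rw [hmc, hd, hmc c a, hmc c b]
      mul_zero := hmz
      zero_mul := fun a => (hmc 0 a).trans (hmz a)
      nsmul := nsmulRec, zsmul := zsmulRec }
  refine ⟨R, ?_⟩
  ext n f x
  · cases f
    · exact c.funMap_add x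
    · exact c.funMap_mul x
    · exact c.funMap_neg x
    · exact c.funMap_zero x
    · exact c.funMap_one x
  · cases f

/-- The commutative ring identities together with `Ψ` axiomatize the class of commutative rings
satisfying `Ψ`. -/
theorem isAxiomatizedBy_commRingIdentities_union (Ψ : Set QuasiIdentity) :
    IsAxiomatizedBy.{u}
      {R | letI := FirstOrder.Ring.compatibleRingOfRing R; ∀ φ ∈ Ψ, φ.Holds R}
      (commRingIdentities ∪ Ψ) := by
  intro M S
  constructor
  · intro h
    obtain ⟨R, hR⟩ := exists_commRing_of_holds M fun φ hφ => h φ (Or.inl hφ)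
    refine ⟨R, hR, ?_⟩
    subst hR
    exact fun φ hφ => h φ (Or.inr hφ)
  · rintro ⟨R, rfl, hΨ⟩ φ (hφ | hφ)
    · let := FirstOrder.Ring.compatibleRingOfRing M
      simp only [commRingIdentities, Set.mem_insert_iff, Set.mem_singleton_iff] at hφ
      rcases hφ with rfl | rfl | rfl | rfl | rfl | rfl | rfl | rfl <;> intro v _ <;>
        simp only [QuasiIdentity.ofEq, FirstOrder.Ring.realize_add, FirstOrder.Ring.realize_mul,
          FirstOrder.Ring.realize_neg, FirstOrder.Ring.realize_zero, FirstOrder.Ring.realize_one] <;>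
        ring
    · exact hΨ φ hφ

/-- Addition and multiplication determine a commutative ring, and both can be read off the
structure. -/
theorem compatibleRingOfRing_toStructure_injective {M : Type u} (R R' : CommRing M)
    (h : (letI := R; FirstOrder.Ring.compatibleRingOfRing M).toStructure =
      (letI := R'; FirstOrder.Ring.compatibleRingOfRing M).toStructure) : R = R' := by
  refine CommRing.ext (funext₂ fun a b => ?_) (funext₂ fun a b => ?_)
  · exact congrArg
      (fun S : Language.ring.Structure M => S.funMap FirstOrder.Ring.addFunc ![a, b]) h
  · exact congrArg
      (fun S : Language.ring.Structure M => S.funMap FirstOrder.Ring.mulFunc ![a, b]) h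

theorem IsAxiomatizedBy.of_mem_iff {K : Set CommRingCat.{u}} {Φ : Set QuasiIdentity}
    (h : IsAxiomatizedBy K Φ) (M : Type u) [R : CommRing M] :
    CommRingCat.of M ∈ K ↔
      let := FirstOrder.Ring.compatibleRingOfRing M; ∀ φ ∈ Φ, φ.Holds M := by
  refine Iff.trans ⟨fun hM => ⟨R, rfl, hM⟩, ?_⟩ (h M _).symm
  rintro ⟨R', hR', hM⟩
  obtain rfl := compatibleRingOfRing_toStructure_injective R R' hR'
  exact hM

theorem realize_ringHom {R S : Type*} [CommRing R] [CommRing S]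
    [FirstOrder.Ring.CompatibleRing R] [FirstOrder.Ring.CompatibleRing S]
    (f : R →+* S) (v : ℕ → R) (t : RingTerm) :
    t.realize (f ∘ v) = f (t.realize v) := by
  induction t with
  | var => rfl
  | func g ts ih => cases g <;> simp [Term.realize, ih]

/-- Identities are inherited by homomorphic images. -/
theorem QuasiIdentity.Holds.of_surjective {R S : Type u} [CommRing R] [CommRing S]
    [FirstOrder.Ring.CompatibleRing R] [FirstOrder.Ring.CompatibleRing S] {φ : QuasiIdentity}
    (hφ : φ.IsIdentity) (h : φ.Holds R) {f : R →+* S} (hf : Function.Surjective f) :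
    φ.Holds S := by
  intro v _
  -- A valuation lifts along the surjection; premises true in `S` need not lift, but an identity has
  -- none.
  obtain ⟨w, rfl⟩ : ∃ w : ℕ → R, f ∘ w = v :=
    ⟨fun n => (hf (v n)).choose, funext fun n => (hf (v n)).choose_spec⟩
  rw [realize_ringHom, realize_ringHom, h w (by simp [show φ.premises = [] from hφ])]

/-- Varieties are closed under quotients. -/
theorem IsVariety.quotient_mem {V : Set CommRingCat.{u}} (hV : IsVariety V) {R : CommRingCat.{u}}
    (hR : R ∈ V) (I : Ideal R) : CommRingCat.of (R ⧸ I) ∈ V := by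
  obtain ⟨Φ, hΦ, hax⟩ := hV
  let := FirstOrder.Ring.compatibleRingOfRing R
  let := FirstOrder.Ring.compatibleRingOfRing (R ⧸ I)
  have h := (hax.of_mem_iff R).1 hR
  exact (hax.of_mem_iff (R ⧸ I)).2 fun φ hφ =>
    (h φ hφ).of_surjective (hΦ φ hφ) Ideal.Quotient.mk_surjective

end Axiomatization

/-! ### The quasi-identity and its first consequences -/

section UniqueGenerators

theorem mem_uniqueGeneratorRings_iff {R : CommRingCat.{u}} :
    R ∈ uniqueGeneratorRings ↔ ∀ x y z : R, x * y * z = z → y * z = z := by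
  constructor
  · intro h x y z hxyz
    refine (h (Ideal.span {z}) inferInstance).unique ?_ rfl
    refine le_antisymm (Ideal.span_singleton_le_span_singleton.2 ⟨y, mul_comm _ _⟩)
      (Ideal.span_singleton_le_span_singleton.2 ⟨x, ?_⟩)
    rw [mul_comm, ← mul_assoc, hxyz]
  · rintro h I ⟨a, rfl⟩
    refine ⟨a, rfl, fun b (hb : Ideal.span {b} = Ideal.span {a}) => ?_⟩
    obtain ⟨y, rfl⟩ := Ideal.span_singleton_le_span_singleton.1 hb.le
    obtain ⟨x, hx⟩ := Ideal.span_singleton_le_span_singleton.1 hb.ge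
    rw [mul_comm]
    exact h x y a (by linear_combination -hx)

theorem unit_eq_one_of_mem {R : CommRingCat.{u}} (hR : R ∈ uniqueGeneratorRings) (a : Rˣ) :
    a = 1 := by
  have := mem_uniqueGeneratorRings_iff.1 hR ↑a⁻¹ a 1 (by simp)
  exact Units.ext (by simpa using this)

theorem isReduced_of_mem {R : CommRingCat.{u}} (hR : R ∈ uniqueGeneratorRings) :
    IsReduced R := by
  refine ⟨fun x hx => ?_⟩
  -- For nilpotent `x`, the unit `x + 1` must equal `1`.
  have h := congrArg Units.val (unit_eq_one_of_mem hR (IsNilpotent.isUnit_add_one hx).unit)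
  simpa using h

theorem algebra_zmod_two_of_mem {R : CommRingCat.{u}} (hR : R ∈ uniqueGeneratorRings) :
    Nonempty (Algebra (ZMod 2) R) := by
  have h : (-1 : R) = 1 := congrArg Units.val (unit_eq_one_of_mem hR (-1))
  have h2 : ((2 : ℕ) : R) = 0 := by
    push_cast
    linear_combination -h
  -- Divisibility suffices here, and covers the zero ring, whose characteristic is `1`.
  exact ⟨ZMod.algebra' R (ringChar R) (ringChar.dvd h2)⟩

theorem isAxiomatizedBy_uniqueGeneratorRings :
    IsAxiomatizedBy uniqueGeneratorRings.{u} (commRingIdentities ∪ {cancelQuasiIdentity}) := by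
  convert isAxiomatizedBy_commRingIdentities_union.{u} {cancelQuasiIdentity} using 1
  ext R
  let := FirstOrder.Ring.compatibleRingOfRing R
  rw [mem_uniqueGeneratorRings_iff]
  simp only [Set.mem_ofPred_eq, Set.mem_singleton_iff, forall_eq, QuasiIdentity.Holds,
    cancelQuasiIdentity, List.mem_singleton, X, Y, Z, FirstOrder.Ring.realize_mul,
    Term.realize_var]
  exact ⟨fun h v => h _ _ _,
    fun h x y z => h fun n => if n = 0 then x else if n = 1 then y else z⟩

theorem isQuasivariety_uniqueGeneratorRings : IsQuasivariety uniqueGeneratorRings.{u} :=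
  ⟨_, isAxiomatizedBy_uniqueGeneratorRings⟩

theorem domainsIn_uniqueGeneratorRings :
    domainsIn uniqueGeneratorRings.{u} = {R : CommRingCat.{u} | IsDomain R ∧ ∀ a : Rˣ, a = 1} := by
  ext R
  refine and_congr_right fun hR => ⟨unit_eq_one_of_mem, fun h => ?_⟩
  refine mem_uniqueGeneratorRings_iff.2 fun x y z hxyz => ?_
  rcases eq_or_ne z 0 with rfl | hz
  · exact mul_zero y
  · have hxy : x * y = 1 := mul_right_cancel₀ hz (by rw [hxyz, one_mul])
    have hy : y = 1 := congrArg Units.val (h ⟨y, x, by rw [mul_comm, hxy], hxy⟩)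
    rw [hy, one_mul]

end UniqueGenerators

/-! ### Relative ideals, prime separation, distributivity -/

section RelativeIdeals

variable {R : Type u} [CommRing R]

theorem mem_relIdeals_iff {I : Ideal R} :
    I ∈ relIdeals uniqueGeneratorRings R ↔ ∀ x y z : R, x * y * z - z ∈ I → y * z - z ∈ I := by
  rw [relIdeals, Set.mem_ofPred_eq, mem_uniqueGeneratorRings_iff]
  simp only [CommRingCat.coe_of, Ideal.Quotient.mk_surjective.forall, ← map_mul,
    Ideal.Quotient.eq]

theorem sInf_mem_relIdeals {S : Set (Ideal R)} (hS : S ⊆ relIdeals uniqueGeneratorRings R) :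
    sInf S ∈ relIdeals uniqueGeneratorRings R :=
  mem_relIdeals_iff.2 fun x y z h => Submodule.mem_sInf.2 fun I hI =>
    mem_relIdeals_iff.1 (hS hI) x y z (Submodule.mem_sInf.1 h I hI)

/-- The premise is a single membership, so it already holds in one member of the chain. This feeds
Zorn's lemma. -/
theorem sSup_mem_relIdeals {C : Set (Ideal R)} (hC : C ⊆ relIdeals uniqueGeneratorRings R)
    (hchain : IsChain (· ≤ ·) C) (hne : C.Nonempty) :
    sSup C ∈ relIdeals uniqueGeneratorRings R := by
  refine mem_relIdeals_iff.2 fun x y z h => ?_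
  rw [Submodule.mem_sSup_of_directed hne hchain.directedOn] at h ⊢
  obtain ⟨I, hI, h⟩ := h
  exact ⟨I, hI, mem_relIdeals_iff.1 (hC hI) x y z h⟩

/-- The ideal quotient `(I : a)` of a relative ideal is a relative ideal. -/
theorem comap_mul_mem_relIdeals {I : Ideal R} (hI : I ∈ relIdeals uniqueGeneratorRings R)
    (a : R) : Submodule.comap (LinearMap.mulLeft R a) I ∈ relIdeals uniqueGeneratorRings R := by
  refine mem_relIdeals_iff.2 fun x y z h => ?_
  simp only [Submodule.mem_comap, LinearMap.mulLeft_apply] at h ⊢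
  have := mem_relIdeals_iff.1 hI x y (a * z) (by convert h using 1; ring)
  convert this using 1
  ring

theorem mem_of_mul_self_mem {I : Ideal R} (hI : I ∈ relIdeals uniqueGeneratorRings R) {a : R}
    (ha : a * a ∈ I) : a ∈ I := by
  -- With this choice `x * y * z - z = -(a * a)` and `y * z - z = a`.
  have := mem_relIdeals_iff.1 hI (1 - a) (1 + a) 1
    (by convert I.neg_mem ha using 1; ring)
  convert this using 1
  ring

/-- Every relative ideal is an intersection of prime relative ideals. -/
theorem exists_isPrime_of_notMem {I : Ideal R} (hI : I ∈ relIdeals uniqueGeneratorRings R) {r : R}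
    (hr : r ∉ I) :
    ∃ P ∈ relIdeals uniqueGeneratorRings R, P.IsPrime ∧ I ≤ P ∧ r ∉ P := by
  obtain ⟨P, hIP, ⟨hP, hrP⟩, hmax⟩ := zorn_le_nonempty₀
    {J : Ideal R | J ∈ relIdeals uniqueGeneratorRings R ∧ r ∉ J}
    (fun C hC hchain J hJ => ⟨sSup C, ⟨sSup_mem_relIdeals (fun K hK => (hC hK).1) hchain ⟨J, hJ⟩,
      fun h => by
        obtain ⟨K, hK, h⟩ := (Submodule.mem_sSup_of_directed ⟨J, hJ⟩ hchain.directedOn).1 h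
        exact (hC hK).2 h⟩, fun K hK => le_sSup hK⟩) I ⟨hI, hr⟩
  -- The quotient `(P : a)` contains `P` and also `b`, so by maximality it cannot avoid `r`.
  have key {a b : R} (hab : a * b ∈ P) (hb : b ∉ P) : a * r ∈ P := by
    by_contra har
    refine hb (hmax (y := Submodule.comap (LinearMap.mulLeft R a) P)
      ⟨comap_mul_mem_relIdeals hP a, har⟩ (fun c hc => P.mul_mem_left a hc) hab)
  refine ⟨P, hP, ⟨fun h => hrP (h ▸ Submodule.mem_top), fun {a b} hab => ?_⟩, hIP, hrP⟩
  by_contra! h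
  -- Applying `key` twice gives first `r * a ∈ P`, then `r * r ∈ P`.
  exact hrP (mem_of_mul_self_mem hP (key (mul_comm a r ▸ key hab h.2) h.1))

theorem inf_relJoin {I J L : Ideal R} (hI : I ∈ relIdeals uniqueGeneratorRings R) :
    I ⊓ relJoin uniqueGeneratorRings J L =
      relJoin uniqueGeneratorRings (I ⊓ J) (I ⊓ L) := by
  apply le_antisymm
  · refine le_sInf fun K ⟨hK, hIJ, hIL⟩ x ⟨hxI, hx⟩ => ?_
    by_contra hxK
    obtain ⟨P, hP, hprime, hKP, hxP⟩ := exists_isPrime_of_notMem hK hxK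
    have hIP : ¬ I ≤ P := fun h => hxP (h hxI)
    have hJP := (hprime.inf_le.1 (hIJ.trans hKP)).resolve_left hIP
    have hLP := (hprime.inf_le.1 (hIL.trans hKP)).resolve_left hIP
    exact hxP (Submodule.mem_sInf.1 hx P ⟨hP, hJP, hLP⟩)
  · refine le_inf (sInf_le ⟨hI, inf_le_left, inf_le_left⟩) (le_sInf fun K ⟨hK, hJK, hLK⟩ => ?_)
    exact sInf_le ⟨hK, inf_le_right.trans hJK, inf_le_right.trans hLK⟩

theorem isRelativelyIdealDistributive_uniqueGeneratorRings :
    IsRelativelyIdealDistributive uniqueGeneratorRings.{u} :=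
  ⟨isQuasivariety_uniqueGeneratorRings, fun _ _ =>
    ⟨fun _ => sInf_mem_relIdeals, fun _ hI _ _ _ _ => inf_relJoin hI⟩⟩

theorem uniqueGeneratorRings_eq_SP :
    uniqueGeneratorRings.{u} = SP (domainsIn uniqueGeneratorRings.{u}) := by
  ext R
  constructor
  · intro hR
    have hbot : (⊥ : Ideal R) ∈ relIdeals uniqueGeneratorRings R :=
      mem_relIdeals_iff.2 fun x y z => by
        simpa only [Ideal.mem_bot, sub_eq_zero] using mem_uniqueGeneratorRings_iff.1 hR x y z
    -- One prime per nonzero element; for the zero ring the product is empty.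
    choose P hP hprime _ hrP using fun r : {r : R // r ∉ (⊥ : Ideal R)} =>
      exists_isPrime_of_notMem hbot r.2
    refine ⟨_, fun r => CommRingCat.of (R ⧸ P r),
      fun r => ⟨(Ideal.Quotient.isDomain_iff_prime _).2 (hprime r), hP r⟩,
      RingHom.pi fun r => Ideal.Quotient.mk (P r), (injective_iff_map_eq_zero _).2 fun a ha => ?_⟩
    by_contra h
    exact hrP ⟨a, h⟩ (Ideal.Quotient.eq_zero_iff_mem.1 (congrFun ha ⟨a, h⟩))
  · rintro ⟨ι, D, hD, f, hf⟩
    refine mem_uniqueGeneratorRings_iff.2 fun x y z h => hf (funext fun i => ?_)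
    have := mem_uniqueGeneratorRings_iff.1 (hD i).2 (f x i) (f y i) (f z i)
      (by simpa using congrFun (congrArg f h) i)
    simpa using this

end RelativeIdeals

/-! ### Boolean rings, local finiteness, subvarieties -/

section Boolean

theorem booleanRings_subset : booleanRings.{u} ⊆ uniqueGeneratorRings := by
  refine fun R hR => mem_uniqueGeneratorRings_iff.2 fun x y z h => ?_
  linear_combination (1 - y) * h + x * z * hR y

theorem isLocallyFinite_of_mem_booleanRings {R : CommRingCat.{u}} (hR : R ∈ booleanRings) :
    IsLocallyFinite R := by
  intro s
  obtain ⟨_⟩ := algebra_zmod_two_of_mem (booleanRings_subset hR)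
  have hint (x : R) : IsIntegral (ZMod 2) x :=
    ⟨Polynomial.X ^ 2 - Polynomial.X, Polynomial.monic_X_pow_sub (by simp), by simp [hR x]⟩
  have := Algebra.finite_adjoin_of_finite_of_isIntegral (R := ZMod 2) s.finite_toSet
    fun x _ => hint x
  have hfin : Finite (Algebra.adjoin (ZMod 2) (s : Set R)) := Module.finite_of_finite (ZMod 2)
  have hle : Subring.closure (s : Set R) ≤ (Algebra.adjoin (ZMod 2) (s : Set R)).toSubring :=
    Subring.closure_le.2 Algebra.subset_adjoin
  exact Set.Finite.subset (s := (Algebra.adjoin (ZMod 2) (s : Set R) : Set R)) hfin hle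

theorem mem_booleanRings_of_isLocallyFinite {R : CommRingCat.{u}}
    (hR : R ∈ uniqueGeneratorRings) (hfin : IsLocallyFinite R) : R ∈ booleanRings := by
  intro a
  have := isReduced_of_mem hR
  have := hfin {a}
  let b : Subring.closure (({a} : Finset R) : Set R) :=
    ⟨a, Subring.subset_closure (by simp)⟩
  obtain ⟨m, n, hmn, h⟩ : ∃ m n : ℕ, m < n ∧ a ^ m = a ^ n := by
    obtain ⟨m, n, hne, h⟩ := Finite.exists_ne_map_eq_of_infinite fun n : ℕ => b ^ n
    have h : a ^ m = a ^ n := congrArg Subtype.val h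
    rcases hne.lt_or_gt with hlt | hlt
    exacts [⟨m, n, hlt, h⟩, ⟨n, m, hlt, h.symm⟩]
  obtain ⟨k, rfl⟩ := Nat.exists_eq_add_of_lt hmn
  have hpow : a * a ^ m = a ^ m := mem_uniqueGeneratorRings_iff.1 hR (a ^ k) a (a ^ m) (by
    conv_rhs => rw [h]
    ring)
  -- `hpow` says `(a - 1) * a ^ m = 0`; the exponent `m + 1` guarantees a factor `a - 1` even when
  -- `m = 0`.
  refine sub_eq_zero.1 (eq_zero_of_pow_eq_zero (n := m + 1) ?_)
  calc (a ^ 2 - a) ^ (m + 1) = (a ^ 2 - a) * (a ^ 2 - a) ^ m := pow_succ' _ _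
    _ = a * (a - 1) * (a ^ m * (a - 1) ^ m) := by rw [← mul_pow]; ring
    _ = 0 := by linear_combination (a * (a - 1) ^ m) * hpow

theorem isVariety_booleanRings : IsVariety booleanRings.{u} := by
  refine ⟨commRingIdentities ∪ {.ofEq (X * X) X}, ?_, ?_⟩
  · simp only [commRingIdentities, Set.mem_union, Set.mem_insert_iff, Set.mem_singleton_iff]
    rintro φ ((rfl | rfl | rfl | rfl | rfl | rfl | rfl | rfl) | rfl) <;> rfl
  · convert isAxiomatizedBy_commRingIdentities_union.{u} {.ofEq (X * X) X} using 1
    ext R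
    let := FirstOrder.Ring.compatibleRingOfRing R
    simp only [booleanRings, Set.mem_ofPred_eq, Set.mem_singleton_iff, forall_eq,
      QuasiIdentity.Holds, QuasiIdentity.ofEq, X, FirstOrder.Ring.realize_mul, Term.realize_var,
      sq]
    exact ⟨fun h v _ => h _, fun h a => h (fun _ => a) (by simp)⟩

theorem IsVariety.subset_booleanRings {V : Set CommRingCat.{u}} (hV : IsVariety V)
    (hsub : V ⊆ uniqueGeneratorRings) : V ⊆ booleanRings := by
  intro R hR a
  -- Closure of varieties under quotients makes this ideal relative, hence radical.
  have ha : a ∈ Ideal.span {a * a} :=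
    mem_of_mul_self_mem (hsub (hV.quotient_mem hR _)) (Ideal.mem_span_singleton_self _)
  obtain ⟨b, hb⟩ := Ideal.mem_span_singleton'.1 ha
  rw [sq]
  exact mem_uniqueGeneratorRings_iff.1 (hsub hR) b a a (by rw [mul_assoc, hb])

end Boolean

end RingClasses

theorem theorem2p1 :
    -- (1)
    (RingClasses.IsQuasivariety RingClasses.uniqueGeneratorRings.{u} ∧
      RingClasses.IsAxiomatizedBy RingClasses.uniqueGeneratorRings.{u}
        (RingClasses.commRingIdentities ∪ {RingClasses.cancelQuasiIdentity}) ∧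
      (∀ R : CommRingCat.{u}, R ∈ RingClasses.uniqueGeneratorRings ↔
        ∀ x y z : R, x * y * z = z → y * z = z) ∧
      (∀ R ∈ RingClasses.uniqueGeneratorRings.{u},
        (∀ a : Rˣ, a = 1) ∧ IsReduced R ∧ Nonempty (Algebra (ZMod 2) R))) ∧
    -- (2)
    (RingClasses.domainsIn RingClasses.uniqueGeneratorRings.{u} =
      {R : CommRingCat.{u} | IsDomain R ∧ ∀ a : Rˣ, a = 1}) ∧
    -- (3)
    (RingClasses.uniqueGeneratorRings.{u} =
      RingClasses.SP (RingClasses.domainsIn RingClasses.uniqueGeneratorRings.{u})) ∧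
    -- (4)
    RingClasses.IsRelativelyIdealDistributive RingClasses.uniqueGeneratorRings.{u} ∧
    -- (5)
    ({R : CommRingCat.{u} | R ∈ RingClasses.uniqueGeneratorRings ∧
        RingClasses.IsLocallyFinite R} = RingClasses.booleanRings ∧
      IsGreatest {V : Set CommRingCat.{u} | RingClasses.IsVariety V ∧
        V ⊆ RingClasses.uniqueGeneratorRings} RingClasses.booleanRings) := by
  open RingClasses in
  exact ⟨⟨isQuasivariety_uniqueGeneratorRings, isAxiomatizedBy_uniqueGeneratorRings,
      fun _ => mem_uniqueGeneratorRings_iff, fun _ hR =>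
        ⟨unit_eq_one_of_mem hR, isReduced_of_mem hR, algebra_zmod_two_of_mem hR⟩⟩,
    domainsIn_uniqueGeneratorRings, uniqueGeneratorRings_eq_SP,
    isRelativelyIdealDistributive_uniqueGeneratorRings,
    Set.Subset.antisymm (fun _ hR => mem_booleanRings_of_isLocallyFinite hR.1 hR.2)
      fun _ hR => ⟨booleanRings_subset hR, isLocallyFinite_of_mem_booleanRings hR⟩,
    ⟨isVariety_booleanRings, booleanRings_subset⟩,
    fun _ hV => hV.1.subset_booleanRings hV.2⟩
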